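/- Let $n\ge 3$ and $N\ge 1$ be integers, let $A\in\mathbb{R}^{n\times n}$ be symmetric, and let $w_1,\dots,w_N$ be independent random vectors in $\mathbb{R}^n$, defined on a common probability space, such that for each $k$ the entries of $w_k$ are independent random variables with mean $0$ and variance $1$. Put $$\widehat A=\frac1N\sum_{k=1}^N A\,w_k w_k^\top ,$$ and for a square matrix $M$ let $D(M)$ denote the diagonal matrix with the same diagonal entries as $M$. For a vector $x$ let $\|x\|_\infty=\max_i|x_i|$; for a matrix $M=(m_{ij})$ let $\|M\|_2$ be the operator norm induced by the Euclidean norm and $\|M\|_\infty=\max_i\sum_j|m_{ij}|$. Assume that $$\mathbb{E}\Big[\max_{1\le k\le N}\|w_k\|_\infty^4\Big]<\infty .$$ Then $\mathbb{E}\big[\|D(\widehat A)-D(A)\|_2^2\big]$ is finite and $$\mathbb{E}\Big[\|D(\widehat A)-D(A)\|_2^2\Big]^{1/2}\le \|A\|_\infty\left(\sqrt{\frac{8e\ln n}{N}}+\frac{8e\ln n}{N}\right)\mathbb{E}\Big[\max_{1\le k\le N}\|w_k\|_\infty^4\Big]^{1/2}.$$ -/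

import Mathlib

open MeasureTheory ProbabilityTheory

noncomputable section

namespace DiagEst

/-- `D(M)`: the diagonal matrix with the same diagonal as `M`. -/
def diagPart {n : ℕ} (M : Matrix (Fin n) (Fin n) ℝ) : Matrix (Fin n) (Fin n) ℝ :=
  Matrix.diagonal M.diag

/-- The Monte Carlo estimator `(1/N) ∑ₖ (A wₖ) wₖᵀ` built from the vectors `w 0, …, w (N-1)`. -/
def estimator {n N : ℕ} (A : Matrix (Fin n) (Fin n) ℝ) (w : Fin N → Fin n → ℝ) :
    Matrix (Fin n) (Fin n) ℝ :=
  (1 / (N : ℝ)) • ∑ k, Matrix.vecMulVec (A.mulVec (w k)) (w k)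

/-- The matrix 2-norm: the operator norm induced by the Euclidean vector norm. -/
def norm2 {n : ℕ} (M : Matrix (Fin n) (Fin n) ℝ) : ℝ :=
  ‖Matrix.toEuclideanCLM (n := Fin n) (𝕜 := ℝ) M‖

/-- The matrix ∞-norm: the operator norm induced by the vector maximum norm
(that is, the largest absolute row sum). -/
def normInf {n : ℕ} (M : Matrix (Fin n) (Fin n) ℝ) : ℝ :=
  letI : NormedAddCommGroup (Matrix (Fin n) (Fin n) ℝ) := Matrix.linftyOpNormedAddCommGroup
  ‖M‖

end DiagEst

end

/-! For a diagonal matrix the 2-norm is the max norm of the diagonal, so the claim concerns a sum of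
independent vectors `sampleDiag N A (w k)` with total mean `A.diag`. Subtracting an independent copy
and exchanging coordinates at random inserts signs (`integral_sq_norm_sum_sub_integral_le`). With
the samples fixed, `mean_sq_norm_sign_sum_le` bounds the second moment of the sign sum by `2 * s *
log (2n)`, where `s` bounds the coordinatewise sums of squares; as `x ↦ cosh √x` is convex, no tail
integration is needed. `sum_sampleDiag_sq_le` bounds these sums by `‖A‖∞² / N` times the maximal
fourth power, and `log (2n) ≤ e log n`. The square-root term alone already suffices. -/

/-! ### Rademacher sums in the max norm. -/

/-- The average of `cosh` dominates `cosh` of the quadratic mean, since `x ↦ cosh √x` is convex. -/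
lemma cosh_sqrt_mean_sq_le {α : Type*} (s : Finset α) (p y : α → ℝ) (hp : ∀ a ∈ s, 0 ≤ p a)
    (hp1 : ∑ a ∈ s, p a = 1) :
    Real.cosh (Real.sqrt (∑ a ∈ s, p a * y a ^ 2)) ≤ ∑ a ∈ s, p a * Real.cosh (y a) := by
  have h0 : 0 ≤ ∑ a ∈ s, p a * y a ^ 2 :=
    Finset.sum_nonneg fun a ha => mul_nonneg (hp a ha) (sq_nonneg _)
  -- Compare power series termwise: the even powers of the square root are integer powers of the
  -- mean, so the power mean inequality applies to each term.
  refine hasSum_le (fun j => ?_) (Real.hasSum_cosh _)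
    (hasSum_sum fun a _ => (Real.hasSum_cosh (y a)).mul_left (p a))
  rw [pow_mul, Real.sq_sqrt h0]
  calc (∑ a ∈ s, p a * y a ^ 2) ^ j / ((2 * j).factorial : ℝ)
      ≤ (∑ a ∈ s, p a * (y a ^ 2) ^ j) / ((2 * j).factorial : ℝ) := by
        gcongr
        exact Real.pow_arith_mean_le_arith_mean_pow s p _ hp hp1 (fun a _ => sq_nonneg _) j
    _ = _ := by
        rw [Finset.sum_div]
        exact Finset.sum_congr rfl fun a _ => by rw [pow_mul, mul_div_assoc]

/-- The sign `±1` attached to a Boolean. -/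
noncomputable def boolSign (b : Bool) : ℝ := if b then 1 else -1

lemma mean_exp_sign_sum {κ : Type*} [Fintype κ] [DecidableEq κ] (a : κ → ℝ) :
    ∑ ε : κ → Bool, ((2 : ℝ) ^ Fintype.card κ)⁻¹ * Real.exp (∑ k, boolSign (ε k) * a k) =
      ∏ k, Real.cosh (a k) := by
  have h : ∏ k, Real.cosh (a k) =
      ∏ k, ∑ b : Bool, (2 : ℝ)⁻¹ * Real.exp (boolSign b * a k) := by
    refine Finset.prod_congr rfl fun k _ => ?_
    simp [boolSign, Real.cosh_eq]
    ring
  rw [h, Fintype.prod_sum]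
  refine Finset.sum_congr rfl fun ε _ => ?_
  rw [Finset.prod_mul_distrib, ← Real.exp_sum]
  simp

lemma mean_exp_sign_sum_le {κ : Type*} [Fintype κ] [DecidableEq κ] (a : κ → ℝ) :
    ∑ ε : κ → Bool, ((2 : ℝ) ^ Fintype.card κ)⁻¹ * Real.exp (∑ k, boolSign (ε k) * a k) ≤
      Real.exp ((∑ k, a k ^ 2) / 2) := by
  rw [mean_exp_sign_sum, Finset.sum_div, Real.exp_sum]
  exact Finset.prod_le_prod (fun k _ => (Real.cosh_pos _).le)
    fun k _ => Real.cosh_le_exp_half_sq _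

lemma mean_cosh_sign_sum_le {κ : Type*} [Fintype κ] [DecidableEq κ] (a : κ → ℝ) :
    ∑ ε : κ → Bool, ((2 : ℝ) ^ Fintype.card κ)⁻¹ * Real.cosh (∑ k, boolSign (ε k) * a k) ≤
      Real.exp ((∑ k, a k ^ 2) / 2) := by
  have h1 := mean_exp_sign_sum_le a
  have h2 := mean_exp_sign_sum_le (fun k => -a k)
  simp only [mul_neg, Finset.sum_neg_distrib, neg_sq] at h2
  have : ∑ ε : κ → Bool, ((2 : ℝ) ^ Fintype.card κ)⁻¹ *
      Real.cosh (∑ k, boolSign (ε k) * a k) =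
      (∑ ε : κ → Bool, ((2 : ℝ) ^ Fintype.card κ)⁻¹ * Real.exp (∑ k, boolSign (ε k) * a k) +
      ∑ ε : κ → Bool, ((2 : ℝ) ^ Fintype.card κ)⁻¹ *
        Real.exp (-∑ k, boolSign (ε k) * a k)) / 2 := by
    rw [← Finset.sum_add_distrib, Finset.sum_div]
    refine Finset.sum_congr rfl fun ε _ => ?_
    rw [Real.cosh_eq]
    ring
  rw [this]
  linarith

/-- The Chernoff optimization: the best choice is `t = m / s`. When `s = 0`, letting `t` grow forces
`m = 0`. -/
lemma sq_le_of_forall_mul_le {m s L : ℝ} (hm : 0 ≤ m) (hs : 0 ≤ s)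
    (h : ∀ t : ℝ, 0 ≤ t → t * m ≤ L + t ^ 2 * s / 2) : m ^ 2 ≤ 2 * s * L := by
  rcases hs.eq_or_lt with rfl | hs
  · rcases hm.eq_or_lt with rfl | hm
    · simp
    · have hL : 0 ≤ L := by simpa using h 0 le_rfl
      have := h ((L + 1) / m) (by positivity)
      rw [div_mul_cancel₀ _ hm.ne'] at this
      simp at this
      linarith
  · have := h (m / s) (by positivity)
    field_simp at this
    nlinarith

lemma sq_norm_le_iff {ι : Type*} [Fintype ι] (v : ι → ℝ) {r : ℝ} (hr : 0 ≤ r) :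
    ‖v‖ ^ 2 ≤ r ↔ ∀ i, v i ^ 2 ≤ r := by
  rw [← Real.le_sqrt (norm_nonneg _) hr, pi_norm_le_iff_of_nonneg (Real.sqrt_nonneg _)]
  exact forall_congr' fun i => by
    rw [Real.norm_eq_abs, Real.le_sqrt (abs_nonneg _) hr, sq_abs]

/-- The second moment of the maximum norm of a Rademacher sum. -/
lemma mean_sq_norm_sign_sum_le {κ ι : Type*} [Fintype κ] [DecidableEq κ] [Fintype ι] [Nonempty ι]
    (z : κ → ι → ℝ) {s : ℝ} (hz : ∀ i, ∑ k, z k i ^ 2 ≤ s) :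
    ∑ ε : κ → Bool, ((2 : ℝ) ^ Fintype.card κ)⁻¹ * ‖∑ k, boolSign (ε k) • z k‖ ^ 2 ≤
      2 * s * Real.log (2 * Fintype.card ι) := by
  classical
  have hs : 0 ≤ s := (Finset.sum_nonneg fun k _ => sq_nonneg _).trans (hz (Classical.arbitrary ι))
  have hcard : (0 : ℝ) < Fintype.card ι := by exact_mod_cast Fintype.card_pos
  set q : ℝ := ∑ ε : κ → Bool, ((2 : ℝ) ^ Fintype.card κ)⁻¹ * ‖∑ k, boolSign (ε k) • z k‖ ^ 2
    with hq
  have hq0 : 0 ≤ q := Finset.sum_nonneg fun ε _ => by positivity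
  rw [← Real.sq_sqrt hq0]
  refine sq_le_of_forall_mul_le (Real.sqrt_nonneg _) hs fun t ht => ?_
  have key : Real.cosh (t * Real.sqrt q) ≤ Fintype.card ι * Real.exp (t ^ 2 * s / 2) := by
    have h1 : t * Real.sqrt q = Real.sqrt (∑ ε : κ → Bool, ((2 : ℝ) ^ Fintype.card κ)⁻¹ *
        (t * ‖∑ k, boolSign (ε k) • z k‖) ^ 2) := by
      rw [← Real.sqrt_sq ht, ← Real.sqrt_mul (sq_nonneg t), hq, Finset.mul_sum]
      rw [Real.sqrt_sq ht]
      congr 1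
      exact Finset.sum_congr rfl fun ε _ => by ring
    rw [h1]
    refine (cosh_sqrt_mean_sq_le _ _ _ (fun _ _ => by positivity) (by simp)).trans ?_
    calc ∑ ε : κ → Bool, ((2 : ℝ) ^ Fintype.card κ)⁻¹ *
          Real.cosh (t * ‖∑ k, boolSign (ε k) • z k‖)
        ≤ ∑ ε : κ → Bool, ((2 : ℝ) ^ Fintype.card κ)⁻¹ *
          ∑ i, Real.cosh (∑ k, boolSign (ε k) * (t * z k i)) := by
          refine Finset.sum_le_sum fun ε _ => mul_le_mul_of_nonneg_left ?_ (by positivity)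
          obtain ⟨i, hi⟩ := Finite.exists_max fun i => ‖(∑ k, boolSign (ε k) • z k) i‖
          have hn : ‖∑ k, boolSign (ε k) • z k‖ = |(∑ k, boolSign (ε k) • z k) i| :=
            le_antisymm ((pi_norm_le_iff_of_nonneg (norm_nonneg _)).2 hi) (norm_le_pi_norm (∑ k, boolSign (ε k) • z k) i)
          -- The norm is attained at coordinate `i`, and `cosh` is even, so one term of the sum over
          -- coordinates equals the left side.
          have he : Real.cosh (t * ‖∑ k, boolSign (ε k) • z k‖) =
              Real.cosh (∑ k, boolSign (ε k) * (t * z k i)) := by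
            rw [hn, ← abs_of_nonneg ht, ← abs_mul, Real.cosh_abs, abs_of_nonneg ht]
            congr 1
            simp only [Finset.sum_apply, Pi.smul_apply, smul_eq_mul, Finset.mul_sum]
            exact Finset.sum_congr rfl fun k _ => by ring
          rw [he]
          exact Finset.single_le_sum
            (f := fun i => Real.cosh (∑ k, boolSign (ε k) * (t * z k i)))
            (fun i _ => (Real.cosh_pos _).le) (Finset.mem_univ i)
      _ = ∑ i, ∑ ε : κ → Bool, ((2 : ℝ) ^ Fintype.card κ)⁻¹ *
          Real.cosh (∑ k, boolSign (ε k) * (t * z k i)) := by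
          simp_rw [Finset.mul_sum]
          exact Finset.sum_comm
      _ ≤ ∑ _i : ι, Real.exp (t ^ 2 * s / 2) := by
          refine Finset.sum_le_sum fun i _ => (mean_cosh_sign_sum_le _).trans ?_
          simp_rw [mul_pow, ← Finset.mul_sum]
          gcongr
          exact hz i
      _ = _ := by simp
  -- The 2 inside the logarithm comes from `exp u ≤ 2 cosh u`.
  have h2 : Real.exp (t * Real.sqrt q) ≤
      Real.exp (Real.log (2 * Fintype.card ι) + t ^ 2 * s / 2) := by
    rw [Real.exp_add, Real.exp_log (by positivity)]
    have := Real.cosh_eq (t * Real.sqrt q)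
    have := Real.exp_pos (-(t * Real.sqrt q))
    linarith
  exact Real.exp_le_exp.1 h2

/-! ### Symmetrization. -/

lemma sq_integral_le_integral_sq {α : Type*} [MeasurableSpace α] {μ : Measure α}
    [IsProbabilityMeasure μ] {f : α → ℝ} (hf : MemLp f 2 μ) :
    (∫ x, f x ∂μ) ^ 2 ≤ ∫ x, f x ^ 2 ∂μ := by
  have h := variance_nonneg f μ
  rw [variance_eq_sub hf] at h
  simpa using h

/-- Exchanging the `k`-th coordinates of two independent copies for a set of indices `k`
preserves the product measure. -/
lemma measurePreserving_exchange {κ X : Type*} [Fintype κ] [MeasurableSpace X]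
    (ν : κ → Measure X) [∀ k, IsProbabilityMeasure (ν k)] (ε : κ → Bool) :
    MeasurePreserving (fun p : (κ → X) × (κ → X) =>
      ((fun k => if ε k then p.1 k else p.2 k), (fun k => if ε k then p.2 k else p.1 k)))
      ((Measure.pi ν).prod (Measure.pi ν)) ((Measure.pi ν).prod (Measure.pi ν)) := by
  have h1 := measurePreserving_arrowProdEquivProdArrow X X κ ν ν
  have h2 := measurePreserving_pi (fun k => (ν k).prod (ν k)) (fun k => (ν k).prod (ν k))
    (f := fun k q => if ε k then q else q.swap) (fun k => by
      cases ε k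
      · simpa using Measure.measurePreserving_swap
      · simp only [↓reduceIte]
        exact MeasurePreserving.id _)
  convert h1.comp (h2.comp h1.symm) using 1
  funext p
  refine Prod.ext (funext fun k => ?_) (funext fun k => ?_) <;>
  · by_cases h : ε k <;>
    simp [h, MeasurableEquiv.arrowProdEquivProdArrow, Equiv.arrowProdEquivProdArrow]

/-- A symmetrization bound for the maximum norm of a centred sum of independent vectors whose
coordinatewise sums of squares are dominated by an integrable function. -/
lemma integral_sq_norm_sum_sub_integral_le {κ ι X : Type*} [Fintype κ] [Fintype ι] [Nonempty ι]
    [MeasurableSpace X] (ν : κ → Measure X) [∀ k, IsProbabilityMeasure (ν k)]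
    (Z : κ → X → ι → ℝ) (hZ : ∀ k, Measurable (Z k)) (V : (κ → X) → ℝ)
    (hV : Integrable V (Measure.pi ν)) (hZV : ∀ x i, ∑ k, Z k (x k) i ^ 2 ≤ V x) :
    Integrable (fun x : κ → X =>
      ‖∑ k, Z k (x k) - ∫ y : κ → X, ∑ k, Z k (y k) ∂Measure.pi ν‖ ^ 2) (Measure.pi ν) ∧
    ∫ x : κ → X, ‖∑ k, Z k (x k) - ∫ y : κ → X, ∑ k, Z k (y k) ∂Measure.pi ν‖ ^ 2 ∂Measure.pi ν ≤
      8 * Real.log (2 * Fintype.card ι) * ∫ x, V x ∂Measure.pi ν := by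
  classical
  set P := Measure.pi ν
  set S : (κ → X) → ι → ℝ := fun x => ∑ k, Z k (x k) with hS
  set L := Real.log (2 * Fintype.card ι)
  have hV0 : ∀ x, 0 ≤ V x := fun x =>
    (Finset.sum_nonneg fun k _ => sq_nonneg _).trans (hZV x (Classical.arbitrary ι))
  have hSm : Measurable S :=
    Finset.measurable_sum _ fun k _ => (hZ k).comp (measurable_pi_apply k)
  -- A crude Cauchy–Schwarz bound, used only for square integrability.
  have hSV : ∀ x, ‖S x‖ ^ 2 ≤ Fintype.card κ * V x := fun x => by
    rw [sq_norm_le_iff _ (mul_nonneg (Nat.cast_nonneg _) (hV0 x))]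
    intro i
    simp only [hS, Finset.sum_apply]
    refine sq_sum_le_card_mul_sum_sq.trans ?_
    rw [Finset.card_univ]
    exact mul_le_mul_of_nonneg_left (hZV x i) (Nat.cast_nonneg _)
  have hS2 : MemLp S 2 P := by
    rw [memLp_two_iff_integrable_sq_norm hSm.aestronglyMeasurable]
    refine (hV.const_mul (Fintype.card κ : ℝ)).mono' (hSm.norm.pow_const 2).aestronglyMeasurable ?_
    filter_upwards with x
    rw [Real.norm_of_nonneg (sq_nonneg _)]
    exact hSV x
  have hS1 : Integrable S P := hS2.integrable one_le_two
  have hsub : ∀ c : ι → ℝ, MemLp (fun x => S x - c) 2 P := fun c => hS2.sub (memLp_const c)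
  have hint : Integrable (fun x => ‖S x - ∫ y, S y ∂P‖ ^ 2) P :=
    (memLp_two_iff_integrable_sq_norm (hsub _).aestronglyMeasurable).1 (hsub _)
  refine ⟨hint, ?_⟩
  have hD : MemLp (fun p : (κ → X) × (κ → X) => S p.1 - S p.2) 2 (P.prod P) :=
    (hS2.comp_fst P).sub (hS2.comp_snd P)
  have hD2 : Integrable (fun p : (κ → X) × (κ → X) => ‖S p.1 - S p.2‖ ^ 2) (P.prod P) :=
    (memLp_two_iff_integrable_sq_norm hD.aestronglyMeasurable).1 hD
  have jensen : ∫ x, ‖S x - ∫ y, S y ∂P‖ ^ 2 ∂P ≤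
      ∫ p : (κ → X) × (κ → X), ‖S p.1 - S p.2‖ ^ 2 ∂P.prod P := by
    rw [integral_prod _ hD2]
    refine integral_mono hint hD2.integral_prod_left fun x => ?_
    have hx : MemLp (fun y => S x - S y) 2 P := (memLp_const (S x)).sub hS2
    have h1 : S x - ∫ y, S y ∂P = ∫ y, (S x - S y) ∂P := by
      rw [integral_sub (integrable_const _) hS1]
      simp
    simp only [h1]
    calc ‖∫ y, (S x - S y) ∂P‖ ^ 2 ≤ (∫ y, ‖S x - S y‖ ∂P) ^ 2 := by
          gcongr
          exact norm_integral_le_integral_norm _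
      _ ≤ _ := sq_integral_le_integral_sq hx.norm
  refine jensen.trans ?_
  let G : (κ → Bool) → (κ → X) × (κ → X) → ℝ :=
    fun ε p => ‖∑ k, boolSign (ε k) • (Z k (p.1 k) - Z k (p.2 k))‖ ^ 2
  let T : (κ → Bool) → (κ → X) × (κ → X) → (κ → X) × (κ → X) := fun ε p =>
      ((fun k => if ε k then p.1 k else p.2 k), (fun k => if ε k then p.2 k else p.1 k))
  have hT : ∀ ε, MeasurePreserving (T ε) (P.prod P) (P.prod P) :=
    fun ε => measurePreserving_exchange ν ε
  -- Exchanging the two copies at index `k` flips the sign of the `k`-th difference.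
  have hGT : ∀ ε, G ε = (fun p => ‖S p.1 - S p.2‖ ^ 2) ∘ T ε := fun ε => by
    funext p
    simp only [G, T, hS, Function.comp, ← Finset.sum_sub_distrib]
    congr 2
    refine Finset.sum_congr rfl fun k _ => ?_
    by_cases h : ε k <;> simp [h, boolSign]
  have hGi : ∀ ε, Integrable (G ε) (P.prod P) := fun ε => by
    rw [hGT]
    exact (hT ε).integrable_comp_of_integrable hD2
  have hGe : ∀ ε, ∫ p, G ε p ∂P.prod P =
      ∫ p : (κ → X) × (κ → X), ‖S p.1 - S p.2‖ ^ 2 ∂P.prod P := fun ε => by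
    have := integral_map (hT ε).aemeasurable (μ := P.prod P)
      (f := fun p : (κ → X) × (κ → X) => ‖S p.1 - S p.2‖ ^ 2)
      (by rw [(hT ε).map_eq]; exact hD2.aestronglyMeasurable)
    rw [(hT ε).map_eq] at this
    rw [this, hGT]
    rfl
  have hmean : ∫ p : (κ → X) × (κ → X), ‖S p.1 - S p.2‖ ^ 2 ∂P.prod P =
      ∫ p, ∑ ε : κ → Bool, ((2 : ℝ) ^ Fintype.card κ)⁻¹ * G ε p ∂P.prod P := by
    rw [integral_finsetSum _ fun ε _ => (hGi ε).const_mul _]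
    simp_rw [integral_const_mul, hGe]
    simp
  have hV1 : Integrable (fun p : (κ → X) × (κ → X) => V p.1) (P.prod P) := hV.comp_fst P
  have hV2 : Integrable (fun p : (κ → X) × (κ → X) => V p.2) (P.prod P) := hV.comp_snd P
  rw [hmean]
  calc ∫ p, ∑ ε : κ → Bool, ((2 : ℝ) ^ Fintype.card κ)⁻¹ * G ε p ∂P.prod P
      ≤ ∫ p : (κ → X) × (κ → X), 4 * L * (V p.1 + V p.2) ∂P.prod P := by
        refine integral_mono (integrable_finsetSum _ fun ε _ => (hGi ε).const_mul _)
          ((hV1.add hV2).const_mul _) fun p => ?_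
        -- With `p` fixed only the signs are averaged, so `s` may depend on `p`; its factor 2 comes
        -- from `(a - b)² ≤ 2(a² + b²)`.
        refine (mean_sq_norm_sign_sum_le (fun k => Z k (p.1 k) - Z k (p.2 k))
          (s := 2 * (V p.1 + V p.2)) fun i => ?_).trans_eq (by ring)
        calc ∑ k, (Z k (p.1 k) - Z k (p.2 k)) i ^ 2
            ≤ ∑ k, 2 * (Z k (p.1 k) i ^ 2 + Z k (p.2 k) i ^ 2) := by
              refine Finset.sum_le_sum fun k _ => ?_
              rw [Pi.sub_apply]
              nlinarith [sq_nonneg (Z k (p.1 k) i + Z k (p.2 k) i)]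
          _ = 2 * (∑ k, Z k (p.1 k) i ^ 2 + ∑ k, Z k (p.2 k) i ^ 2) := by
              rw [← Finset.mul_sum, Finset.sum_add_distrib]
          _ ≤ _ := by linarith [hZV p.1 i, hZV p.2 i]
    _ = 8 * L * ∫ x, V x ∂P := by
        rw [integral_const_mul, integral_add hV1 hV2, integral_fun_fst, integral_fun_snd]
        simp
        ring

/-! ### The diagonal of the estimator: size and mean. -/

namespace DiagEst

lemma norm2_diagPart_sub {n : ℕ} (M M' : Matrix (Fin n) (Fin n) ℝ) :
    norm2 (diagPart M - diagPart M') = ‖M.diag - M'.diag‖ := by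
  rw [norm2, diagPart, diagPart, Matrix.diagonal_sub, Matrix.l2_opNorm_toEuclideanCLM,
    Matrix.l2_opNorm_diagonal]
  rfl

lemma normInf_nonneg {n : ℕ} (A : Matrix (Fin n) (Fin n) ℝ) : 0 ≤ normInf A := by
  let _ : NormedAddCommGroup (Matrix (Fin n) (Fin n) ℝ) := Matrix.linftyOpNormedAddCommGroup
  exact norm_nonneg A

lemma norm_mulVec_le_normInf {n : ℕ} (A : Matrix (Fin n) (Fin n) ℝ) (x : Fin n → ℝ) :
    ‖A.mulVec x‖ ≤ normInf A * ‖x‖ :=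
  Matrix.linfty_opNorm_mulVec A x

/-- The contribution of a single sample vector to the diagonal of the estimator. -/
noncomputable def sampleDiag {n : ℕ} (N : ℕ) (A : Matrix (Fin n) (Fin n) ℝ) (x : Fin n → ℝ) : Fin n → ℝ :=
  fun i => 1 / (N : ℝ) * (A.mulVec x i * x i)

lemma diag_estimator {n N : ℕ} (A : Matrix (Fin n) (Fin n) ℝ) (x : Fin N → Fin n → ℝ) :
    (estimator A x).diag = ∑ k, sampleDiag N A (x k) := by
  funext i
  simp [estimator, sampleDiag, Matrix.sum_apply, Matrix.vecMulVec_apply, Finset.mul_sum]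

lemma measurable_sampleDiag {n : ℕ} (N : ℕ) (A : Matrix (Fin n) (Fin n) ℝ) :
    Measurable (sampleDiag N A) := by
  refine measurable_pi_lambda _ fun i => ?_
  simp only [sampleDiag, Matrix.mulVec, dotProduct]
  fun_prop

lemma norm_pow_four_le_iSup {n N : ℕ} (x : Fin N → Fin n → ℝ) (k : Fin N) :
    ‖x k‖ ^ 4 ≤ ⨆ k, ‖x k‖ ^ 4 :=
  le_ciSup (f := fun k => ‖x k‖ ^ 4) (Set.finite_range _).bddAbove k

lemma sum_sampleDiag_sq_le {n N : ℕ} (hN : 1 ≤ N) (A : Matrix (Fin n) (Fin n) ℝ)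
    (x : Fin N → Fin n → ℝ) (i : Fin n) :
    ∑ k, sampleDiag N A (x k) i ^ 2 ≤ normInf A ^ 2 / N * ⨆ k, ‖x k‖ ^ 4 := by
  have hN0 : (0 : ℝ) < N := by exact_mod_cast hN
  calc ∑ k, sampleDiag N A (x k) i ^ 2
      ≤ ∑ _k : Fin N, (1 / (N : ℝ)) ^ 2 * (normInf A ^ 2 * ⨆ k, ‖x k‖ ^ 4) := by
        refine Finset.sum_le_sum fun k _ => ?_
        rw [sampleDiag, mul_pow]
        gcongr
        have h1 : |A.mulVec (x k) i * x k i| ≤ normInf A * ‖x k‖ * ‖x k‖ := by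
          rw [abs_mul]
          exact mul_le_mul ((norm_le_pi_norm (A.mulVec (x k)) i).trans
            (norm_mulVec_le_normInf A _)) (norm_le_pi_norm (x k) i) (abs_nonneg _)
            (mul_nonneg (normInf_nonneg A) (norm_nonneg _))
        calc (A.mulVec (x k) i * x k i) ^ 2 = |A.mulVec (x k) i * x k i| ^ 2 := (sq_abs _).symm
          _ ≤ (normInf A * ‖x k‖ * ‖x k‖) ^ 2 := by gcongr
          _ = normInf A ^ 2 * ‖x k‖ ^ 4 := by ring
          _ ≤ _ := mul_le_mul_of_nonneg_left (norm_pow_four_le_iSup x k) (sq_nonneg _)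
    _ = _ := by
        simp only [Finset.sum_const, Finset.card_univ, Fintype.card_fin, nsmul_eq_mul]
        field_simp

/-- Since `n ≥ 3`, the logarithm of `2n` is at most `e log n`. -/
lemma log_two_mul_le {n : ℕ} (hn : 3 ≤ n) :
    Real.log (2 * n) ≤ Real.exp 1 * Real.log n := by
  have hn' : (3 : ℝ) ≤ n := by exact_mod_cast hn
  have h2 : Real.log 2 ≤ Real.log n := Real.log_le_log (by norm_num) (by linarith)
  have h0 : 0 ≤ Real.log n := Real.log_nonneg (by linarith)
  rw [Real.log_mul (by norm_num) (by linarith)]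
  -- `log 2 + log n ≤ 2 log n ≤ e log n`.
  nlinarith [Real.exp_one_gt_two]

lemma integrable_apply_mul_apply {Ω : Type*} [MeasurableSpace Ω] {μ : Measure Ω}
    [IsProbabilityMeasure μ] {n N : ℕ} {w : Fin N → Ω → (Fin n → ℝ)}
    (hmeas : ∀ k, Measurable (w k))
    (hfourth : Integrable (fun ω => ⨆ k : Fin N, ‖w k ω‖ ^ 4) μ) (k : Fin N) (i j : Fin n) :
    Integrable (fun ω => w k ω j * w k ω i) μ := by
  have hm : ∀ i, Measurable fun ω => w k ω i := fun i => (measurable_pi_apply i).comp (hmeas k)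
  refine ((integrable_const 1).add hfourth).mono' ((hm j).mul (hm i)).aestronglyMeasurable ?_
  filter_upwards with ω
  have h1 : ‖w k ω j * w k ω i‖ ≤ ‖w k ω‖ * ‖w k ω‖ := by
    rw [norm_mul]
    exact mul_le_mul (norm_le_pi_norm _ _) (norm_le_pi_norm _ _) (norm_nonneg _) (norm_nonneg _)
  have h2 := norm_pow_four_le_iSup (fun k => w k ω) k
  simp only [Pi.add_apply]
  nlinarith [sq_nonneg (‖w k ω‖ ^ 2 - 1)]

lemma integral_apply_mul_apply {Ω : Type*} [MeasurableSpace Ω] {μ : Measure Ω}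
    [IsProbabilityMeasure μ] {n : ℕ} {x : Ω → (Fin n → ℝ)} (hx : Measurable x)
    (hind : iIndepFun (fun (i : Fin n) (ω : Ω) => x ω i) μ)
    (hmean : ∀ i, ∫ ω, x ω i ∂μ = 0) (hvar : ∀ i, variance (fun ω => x ω i) μ = 1)
    (hint : ∀ i, Integrable (fun ω => x ω i * x ω i) μ) (i j : Fin n) :
    ∫ ω, x ω j * x ω i ∂μ = if j = i then 1 else 0 := by
  have hm : ∀ i, Measurable fun ω => x ω i := fun i => (measurable_pi_apply i).comp hx
  split_ifs with hij
  · subst hij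
    have h2 : MemLp (fun ω => x ω j) 2 μ := by
      rw [memLp_two_iff_integrable_sq (hm j).aestronglyMeasurable]
      simpa only [sq] using hint j
    have := hvar j
    rw [variance_eq_sub h2, hmean j] at this
    simpa [sq] using this
  · rw [(hind.indepFun hij).integral_fun_mul_eq_mul_integral (hm j).aestronglyMeasurable
      (hm i).aestronglyMeasurable, hmean, zero_mul]

lemma integral_sum_sampleDiag {Ω : Type*} [MeasurableSpace Ω] {μ : Measure Ω}
    [IsProbabilityMeasure μ] {n N : ℕ} (hN : 1 ≤ N) (A : Matrix (Fin n) (Fin n) ℝ)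
    {w : Fin N → Ω → (Fin n → ℝ)}
    (hint : ∀ k i j, Integrable (fun ω => w k ω j * w k ω i) μ)
    (hcov : ∀ k i j, ∫ ω, w k ω j * w k ω i ∂μ = if j = i then 1 else 0) :
    ∫ ω, ∑ k, sampleDiag N A (w k ω) ∂μ = A.diag := by
  have hN0 : (N : ℝ) ≠ 0 := by positivity
  have hexp : ∀ k i ω, sampleDiag N A (w k ω) i =
      1 / (N : ℝ) * ∑ j, A i j * (w k ω j * w k ω i) := fun k i ω => by
    simp [sampleDiag, Matrix.mulVec, dotProduct, Finset.sum_mul, mul_assoc]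
  have hs : ∀ k i, Integrable (fun ω => sampleDiag N A (w k ω) i) μ := fun k i => by
    simp_rw [hexp]
    exact (integrable_finsetSum _ fun j _ => (hint k i j).const_mul _).const_mul _
  funext i
  rw [eval_integral fun i => by
    simp only [Finset.sum_apply]
    exact integrable_finsetSum _ fun k _ => hs k i]
  simp only [Finset.sum_apply]
  rw [integral_finsetSum _ fun k _ => hs k i]
  have hk : ∀ k, ∫ ω, sampleDiag N A (w k ω) i ∂μ = 1 / (N : ℝ) * A i i := fun k => by
    simp_rw [hexp]
    rw [integral_const_mul, integral_finsetSum _ fun j _ => (hint k i j).const_mul _]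
    simp_rw [integral_const_mul, hcov]
    simp
  simp_rw [hk]
  simp [hN0]

end DiagEst

/-! ### Transfer to the joint law of the samples and conclusion. -/

theorem theorem4p1 {Ω : Type*} [MeasurableSpace Ω] (μ : Measure Ω) [IsProbabilityMeasure μ]
    (n N : ℕ) (hn : 3 ≤ n) (hN : 1 ≤ N)
    (A : Matrix (Fin n) (Fin n) ℝ) (hA : A.IsSymm)
    (w : Fin N → Ω → (Fin n → ℝ))
    (hmeas : ∀ k, Measurable (w k))
    (hvec : iIndepFun w μ)
    (hent : ∀ k, iIndepFun (fun (i : Fin n) (ω : Ω) => w k ω i) μ)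
    (hmean : ∀ k i, ∫ ω, w k ω i ∂μ = 0)
    (hvar : ∀ k i, variance (fun ω => w k ω i) μ = 1)
    -- on `Fin n → ℝ`, the norm is the maximum norm
    (hfourth : Integrable (fun ω => ⨆ k : Fin N, ‖w k ω‖ ^ 4) μ) :
    Integrable (fun ω => DiagEst.norm2
      (DiagEst.diagPart (DiagEst.estimator A (fun k => w k ω)) - DiagEst.diagPart A) ^ 2) μ ∧
    Real.sqrt (∫ ω, DiagEst.norm2
      (DiagEst.diagPart (DiagEst.estimator A (fun k => w k ω)) - DiagEst.diagPart A) ^ 2 ∂μ) ≤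
      DiagEst.normInf A *
        (Real.sqrt (8 * Real.exp 1 * Real.log n / N) + 8 * Real.exp 1 * Real.log n / N) *
        Real.sqrt (∫ ω, (⨆ k : Fin N, ‖w k ω‖ ^ 4) ∂μ) := by
  have hN0 : (0 : ℝ) < N := by exact_mod_cast hN
  have hn1 : (1 : ℝ) ≤ n := by exact_mod_cast (by omega : 1 ≤ n)
  have hlog : 0 ≤ Real.log n := Real.log_nonneg hn1
  have : Nonempty (Fin n) := ⟨⟨0, by omega⟩⟩
  have : ∀ k, IsProbabilityMeasure (μ.map (w k)) := fun k =>
    Measure.isProbabilityMeasure_map (hmeas k).aemeasurable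
  set P := Measure.pi fun k => μ.map (w k) with hP
  let W : Ω → Fin N → Fin n → ℝ := fun ω k => w k ω
  have hW : Measurable W := measurable_pi_lambda _ hmeas
  -- Independence of the vectors makes their joint law a product, as the symmetrization bound
  -- requires.
  have hlaw : μ.map W = P :=
    (iIndepFun_iff_map_fun_eq_pi_map fun k => (hmeas k).aemeasurable).1 hvec
  have hint := DiagEst.integrable_apply_mul_apply hmeas hfourth
  have hmom : ∫ ω, ∑ k, DiagEst.sampleDiag N A (w k ω) ∂μ = A.diag :=
    DiagEst.integral_sum_sampleDiag hN A hint fun k =>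
      DiagEst.integral_apply_mul_apply (hmeas k) (hent k) (hmean k) (hvar k)
        fun i => hint k i i
  let F : (Fin N → Fin n → ℝ) → Fin n → ℝ := fun x => ∑ k, DiagEst.sampleDiag N A (x k)
  have hF : Measurable F := Finset.measurable_sum _ fun k _ =>
    (DiagEst.measurable_sampleDiag N A).comp (measurable_pi_apply k)
  let V : (Fin N → Fin n → ℝ) → ℝ := fun x => DiagEst.normInf A ^ 2 / N * ⨆ k, ‖x k‖ ^ 4
  have hV : Measurable V := by
    refine Measurable.const_mul (Measurable.iSup fun k => ?_) _
    exact (measurable_pi_apply k).norm.pow_const 4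
  have hFP : ∫ x, F x ∂P = A.diag := by
    rw [← hlaw, integral_map hW.aemeasurable hF.aestronglyMeasurable]
    exact hmom
  have hVP : Integrable V P := by
    rw [← hlaw, integrable_map_measure hV.aestronglyMeasurable hW.aemeasurable]
    exact hfourth.const_mul _
  have hVint : ∫ x, V x ∂P =
      DiagEst.normInf A ^ 2 / N * ∫ ω, (⨆ k : Fin N, ‖w k ω‖ ^ 4) ∂μ := by
    rw [← hlaw, integral_map hW.aemeasurable hV.aestronglyMeasurable, ← integral_const_mul]
  obtain ⟨hI, hle⟩ := integral_sq_norm_sum_sub_integral_le (fun k => μ.map (w k))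
    (fun _ => DiagEst.sampleDiag N A) (fun _ => DiagEst.measurable_sampleDiag N A) V hVP
    (DiagEst.sum_sampleDiag_sq_le hN A)
  change Integrable (fun x => ‖F x - ∫ y, F y ∂P‖ ^ 2) P at hI
  change ∫ x, ‖F x - ∫ y, F y ∂P‖ ^ 2 ∂P ≤ _ * ∫ x, V x ∂P at hle
  have hQ : Measurable fun x => ‖F x - A.diag‖ ^ 2 := (hF.sub_const _).norm.pow_const 2
  rw [hFP, ← hlaw, integrable_map_measure hQ.aestronglyMeasurable hW.aemeasurable] at hI
  rw [hFP, hVint, ← hlaw, integral_map hW.aemeasurable hQ.aestronglyMeasurable,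
    Fintype.card_fin] at hle
  simp_rw [DiagEst.norm2_diagPart_sub, DiagEst.diag_estimator]
  refine ⟨hI, ?_⟩
  have hE0 : 0 ≤ ∫ ω, (⨆ k : Fin N, ‖w k ω‖ ^ 4) ∂μ :=
    integral_nonneg fun ω => Real.iSup_nonneg fun k => by positivity
  have hc := DiagEst.normInf_nonneg A
  set c := DiagEst.normInf A
  set E := ∫ ω, (⨆ k : Fin N, ‖w k ω‖ ^ 4) ∂μ
  set a := 8 * Real.exp 1 * Real.log n / N with ha
  have ha0 : 0 ≤ a := by positivity
  calc Real.sqrt (∫ ω, ‖∑ k, DiagEst.sampleDiag N A (w k ω) - A.diag‖ ^ 2 ∂μ)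
      ≤ Real.sqrt (c ^ 2 * a * E) := by
        refine Real.sqrt_le_sqrt (hle.trans ?_)
        calc 8 * Real.log (2 * n) * (c ^ 2 / N * E)
            ≤ 8 * (Real.exp 1 * Real.log n) * (c ^ 2 / N * E) := by
              gcongr
              exact DiagEst.log_two_mul_le hn
          _ = c ^ 2 * a * E := by rw [ha]; ring
    _ = c * Real.sqrt a * Real.sqrt E := by
        rw [Real.sqrt_mul (by positivity), Real.sqrt_mul (sq_nonneg c), Real.sqrt_sq hc]
    -- The summand `a` is pure slack.
    _ ≤ c * (Real.sqrt a + a) * Real.sqrt E := by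
        gcongr
        linarith
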